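/- **Theorem 1.2 (Powers of directed paths).** A cut in a digraph $D=(V,A)$ is a set of arcs $\{uv\in A : u\in U,\ v\notin U\}$ for some $U\subseteq V$; $D$ is covered by $k$ cuts if $A$ is the union of $k$ cuts (not necessarily distinct). Let $P_n^d$ be the digraph on $\{0,\dots,n-1\}$ that contains an arc $ij$ if and only if $j-i\in\{1,\dots,d\}$. For $k\ge 1$, let $\delta(k)$ be the maximum $d$ such that, for all $n\in\mathbb N$, $P_n^d$ is covered by $k$ cuts. Then: 1. For all $k\ge 4$, $\ \delta(k)\ge \tfrac{5}{16}2^k$. 2. If $r\ge 1$ is a power of $2$ (with $r=2^0=1$ allowed), $k\ge 1$ and $k\ge r\log_2 r$, then $\ \delta(k)\ge \left(1-\tfrac1r\right)^r 2^k\ge \left(1-\tfrac1r\right)\tfrac1e 2^k$. 3. For all $k\ge 1$ and $d\ge 0$, $P^d_{2^k+1}$ is covered by $k$ cuts if and only if $d\le 2^k-2^{\lfloor k/2\rfloor}-2^{\lceil k/2\rceil}+1$. 4. $P_n^3$ is covered by $3$ cuts if and only if $n\le 10$; moreover, $\delta(3)=2$. 5. $P_n^6$ is covered by $4$ cuts if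 and only if $n\le 24$; moreover, $\delta(4)=5$. 6. For all $k\ge 3$, $\ \delta(k)\le \tfrac12 2^k-2$. -/

import Mathlib

namespace CutCover

/-- The arc set of a digraph. -/
def arcs {V : Type*} (D : Digraph V) : Set (V × V) := {e | D.Adj e.1 e.2}

/-- The cut of `D` given by a vertex set `U`: all arcs that lead from `U` to its complement. -/
def cut {V : Type*} (D : Digraph V) (U : Set V) : Set (V × V) :=
  {e | e ∈ arcs D ∧ e.1 ∈ U ∧ e.2 ∉ U}

/-- `D` is covered by `k` cuts: its arc set is the union of `k` cuts of `D`. -/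
def CoveredByCuts {V : Type*} (D : Digraph V) (k : ℕ) : Prop :=
  ∃ U : Fin k → Set V, arcs D = ⋃ a, cut D (U a)

/-- The `d`-th power of the directed path on `n` vertices: the digraph on `{0, …, n - 1}` that
contains the arc `i j` if and only if `j - i ∈ {1, …, d}` (the difference is an integer). -/
def pathPower (n d : ℕ) : Digraph (Fin n) where
  Adj i j := ((j : ℕ) : ℤ) - ((i : ℕ) : ℤ) ∈ Set.Icc (1 : ℤ) (d : ℤ)

/-- The set of all `d` such that every `d`-th power of a directed path is covered by `k` cuts. -/
def coverableExponents (k : ℕ) : Set ℕ := {d | ∀ n : ℕ, CoveredByCuts (pathPower n d) k}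

/-- The largest `d` such that, for all `n`, the `d`-th power of the directed path on `n` vertices
is covered by `k` cuts. The maximum exists, see `isGreatest_delta`. -/
noncomputable def delta (k : ℕ) : ℕ := sSup (coverableExponents k)

theorem zero_mem_coverableExponents (k : ℕ) : 0 ∈ coverableExponents k := by
  intro n
  have h : arcs (pathPower n 0) = ∅ := by
    ext ⟨i, j⟩
    simp only [arcs, pathPower, Set.mem_ofPred_eq, Set.mem_Icc, Set.mem_empty_iff_false, iff_false]
    omega
  refine ⟨fun _ => ∅, ?_⟩
  rw [h]
  ext e
  simp [cut]

theorem lt_two_pow_of_mem {k d : ℕ} (hd : d ∈ coverableExponents k) : d < 2 ^ k := by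
  classical
  by_contra hlt
  obtain ⟨U, hU⟩ := hd (2 ^ k + 1)
  have key : ∀ i j : Fin (2 ^ k + 1), i < j → ∃ a, i ∈ U a ∧ j ∉ U a := by
    intro i j hij
    have hmem : (i, j) ∈ arcs (pathPower (2 ^ k + 1) d) := by
      have h1 : (i : ℕ) < (j : ℕ) := hij
      have h2 := j.isLt
      simp only [arcs, pathPower, Set.mem_ofPred_eq, Set.mem_Icc]
      omega
    rw [hU] at hmem
    obtain ⟨a, ha⟩ := Set.mem_iUnion.1 hmem
    exact ⟨a, ha.2⟩
  have hinj : Function.Injective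
      (fun i : Fin (2 ^ k + 1) => (Finset.univ.filter fun a : Fin k => i ∈ U a)) := by
    intro i j hij
    have hiff : ∀ a, i ∈ U a ↔ j ∈ U a := by
      intro a
      have := congrArg (fun s : Finset (Fin k) => a ∈ s) hij
      simpa using this
    rcases lt_trichotomy i j with h | h | h
    · obtain ⟨a, h1, h2⟩ := key i j h
      exact absurd ((hiff a).1 h1) h2
    · exact h
    · obtain ⟨a, h1, h2⟩ := key j i h
      exact absurd ((hiff a).2 h1) h2
  have hcard := Fintype.card_le_of_injective _ hinj
  simp at hcard

/-- `delta k` is attained: it is the maximum of the set that defines it. -/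
theorem isGreatest_delta (k : ℕ) : IsGreatest (coverableExponents k) (delta k) := by
  have hb : BddAbove (coverableExponents k) := ⟨2 ^ k, fun _ hd => (lt_two_pow_of_mem hd).le⟩
  exact ⟨Nat.sSup_mem ⟨0, zero_mem_coverableExponents k⟩ hb, fun _ hd => le_csSup hb hd⟩

end CutCover

/-! ### Coverings by cuts as set labellings -/

namespace CutCover

/-! Label each vertex by the set of cuts whose source side contains it. An arc is covered iff the
label of its tail is not contained in that of its head, so everything concerns sequences of sets in
which no set lies in one of the next `d` (`coveredByCuts_iff`).

Lower bounds: splitting every vertex in two doubles `d` at the cost of one cut (`two_mul_delta_le`).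
The starting points are the six pairs of a 4-set, repeated cyclically, and sequences of integer
vectors written in binary (`pow_le_delta`).

On `2 ^ k + 1` vertices some label `S` repeats. A closest repetition encloses at least `d` distinct
sets incomparable with `S` (`IsGood.add_le`); conversely, listing supersets, `S`, incomparable sets,
`S`, subsets attains this count (`exists_isGood_of_card`).

For the general upper bound let `2 ^ k = 4 * p` and `d = 2 * p - 1`. The Harris–Kleitman inequality
for the lower sets generated by adjacent windows of `p` labels forces these, far from the ends, to
contain exactly half of all sets. Equality then makes the labels alternate with period 2, which is
impossible (`IsGood.length_lt`).

The exact thresholds for 3 and 4 cuts come from explicit labellings and a verified exhaustive search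
(`IsMaskGood.canExtend_eq_true`), cut down by symmetry for 4 cuts. -/

theorem mem_arcs_pathPower {n d : ℕ} {i j : Fin n} :
    (i, j) ∈ arcs (pathPower n d) ↔ (i : ℕ) < j ∧ (j : ℕ) ≤ i + d := by
  simp only [arcs, pathPower, Set.mem_ofPred_eq, Set.mem_Icc]
  omega

/-- A labelling of the first `n` vertices by sets in which no label is contained in the label of
one of the next `d` vertices. -/
def IsGood {α : Type*} (n d : ℕ) (f : ℕ → Finset α) : Prop :=
  ∀ i j : ℕ, i < j → j ≤ i + d → j < n → ¬ f i ⊆ f j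

theorem IsGood.mono {α : Type*} {n d n' d' : ℕ} {f : ℕ → Finset α} (h : IsGood n d f)
    (hn : n' ≤ n) (hd : d' ≤ d) : IsGood n' d' f :=
  fun i j h1 h2 h3 => h i j h1 (by omega) (by omega)

theorem coveredByCuts_iff {n d k : ℕ} :
    CoveredByCuts (pathPower n d) k ↔ ∃ f : ℕ → Finset (Fin k), IsGood n d f := by
  classical
  constructor
  · rintro ⟨U, hU⟩
    refine ⟨fun i => if h : i < n then Finset.univ.filter fun a => (⟨i, h⟩ : Fin n) ∈ U a else ∅,
      fun i j hij hjd hjn hsub => ?_⟩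
    have hin : i < n := by omega
    have hmem : ((⟨i, hin⟩ : Fin n), (⟨j, hjn⟩ : Fin n)) ∈ arcs (pathPower n d) :=
      mem_arcs_pathPower.2 ⟨hij, hjd⟩
    rw [hU] at hmem
    obtain ⟨a, -, h1, h2⟩ := Set.mem_iUnion.1 hmem
    simp only [hin, hjn, dif_pos] at hsub
    have := hsub (Finset.mem_filter.2 ⟨Finset.mem_univ a, h1⟩)
    exact h2 (Finset.mem_filter.1 this).2
  · rintro ⟨f, hf⟩
    refine ⟨fun a => {i | a ∈ f i}, ?_⟩
    ext ⟨i, j⟩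
    constructor
    · intro h
      obtain ⟨h1, h2⟩ := mem_arcs_pathPower.1 h
      obtain ⟨a, ha, hb⟩ := Finset.not_subset.1 (hf i j h1 h2 j.isLt)
      exact Set.mem_iUnion.2 ⟨a, h, ha, hb⟩
    · intro h
      obtain ⟨a, h1, -⟩ := Set.mem_iUnion.1 h
      exact h1

theorem CoveredByCuts.mono {n d k n' d' : ℕ} (h : CoveredByCuts (pathPower n d) k)
    (hn : n' ≤ n) (hd : d' ≤ d) : CoveredByCuts (pathPower n' d') k := by
  obtain ⟨f, hf⟩ := coveredByCuts_iff.1 h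
  exact coveredByCuts_iff.2 ⟨f, hf.mono hn hd⟩

theorem coveredByCuts_of_le_delta {d k : ℕ} (h : d ≤ delta k) (n : ℕ) :
    CoveredByCuts (pathPower n d) k :=
  ((isGreatest_delta k).1 n).mono le_rfl h

theorem delta_lt_of_not_covered {n d k : ℕ} (h : ¬ CoveredByCuts (pathPower n d) k) :
    delta k < d := by
  by_contra hlt
  exact h (coveredByCuts_of_le_delta (not_lt.1 hlt) n)

theorem le_delta {d k : ℕ} (h : ∀ n, CoveredByCuts (pathPower n d) k) : d ≤ delta k :=
  (isGreatest_delta k).2 h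

/-- Labels over any index type with `k` elements give a covering by `k` cuts. -/
theorem coveredByCuts_of_card {ι : Type*} [Fintype ι] {n d k : ℕ} (hk : Fintype.card ι = k)
    (P : ℕ → ι → Prop)
    (h : ∀ i j : ℕ, i < j → j ≤ i + d → j < n → ∃ a, P i a ∧ ¬ P j a) :
    CoveredByCuts (pathPower n d) k := by
  classical
  let e : ι ≃ Fin k := Fintype.equivFinOfCardEq hk
  refine coveredByCuts_iff.2 ⟨fun i => Finset.univ.filter fun a => P i (e.symm a),
    fun i j h1 h2 h3 hsub => ?_⟩
  obtain ⟨a, ha, hb⟩ := h i j h1 h2 h3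
  have := hsub (Finset.mem_filter.2 ⟨Finset.mem_univ (e a), by simpa using ha⟩)
  exact hb (by simpa using this)

/-! ### Lower bounds by doubling and by block sequences -/

/-- Replace each label by two labels, the first of which has an additional element. -/
theorem two_mul_delta_le (k : ℕ) : 2 * delta k ≤ delta (k + 1) := by
  refine le_delta fun n => ?_
  obtain ⟨f, hf⟩ := coveredByCuts_iff.1 (coveredByCuts_of_le_delta (le_refl (delta k)) n)
  refine coveredByCuts_of_card (ι := Option (Fin k)) (by simp)
    (fun t o => o.elim (t % 2 = 0) fun a => a ∈ f (t / 2)) fun i j h1 h2 h3 => ?_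
  by_cases h : i / 2 = j / 2
  · exact ⟨none, by simp only [Option.elim]; omega, by simp only [Option.elim]; omega⟩
  · obtain ⟨a, ha, hb⟩ := Finset.not_subset.1
      (hf (i / 2) (j / 2) (by omega) (by omega) (by omega))
    exact ⟨some a, ha, hb⟩

theorem two_pow_mul_delta_le (k j : ℕ) : 2 ^ j * delta k ≤ delta (k + j) := by
  induction j with
  | zero => simp
  | succ j ih =>
    calc 2 ^ (j + 1) * delta k = 2 * (2 ^ j * delta k) := by ring
      _ ≤ 2 * delta (k + j) := by omega
      _ ≤ delta (k + (j + 1)) := two_mul_delta_le _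

/-- If every bit of `b` were a bit of `a`, then `b ≤ a`. Hence `m` cuts can encode a coordinate
below `2 ^ m` in binary, and any decrease of it over time is seen by one of them. -/
theorem exists_testBit_of_lt {m a b : ℕ} (hab : a < b) (hb : b < 2 ^ m) :
    ∃ i < m, b.testBit i = true ∧ a.testBit i = false := by
  by_contra hcon
  push Not at hcon
  have hand : b &&& a = b := by
    apply Nat.eq_of_testBit_eq
    intro i
    rw [Nat.testBit_and]
    by_cases hbi : b.testBit i = true
    · have him : i < m := by
        by_contra him
        rw [Nat.testBit_lt_two_pow (lt_of_lt_of_le hb (Nat.pow_le_pow_right two_pos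
          (not_lt.1 him)))] at hbi
        exact absurd hbi (by simp)
      have := hcon i him hbi
      simp_all
    · simp_all
  have := @Nat.and_le_right b a
  omega

theorem exists_digit_lt {B n a b : ℕ} (hab : a < b) (hb : b < B ^ n) :
    ∃ i < n, a / B ^ i % B < b / B ^ i % B := by
  induction n generalizing a b with
  | zero => simp at hb; omega
  | succ n ih =>
    by_cases h : a / B < b / B
    · have hB : 0 < B := by
        rcases Nat.eq_zero_or_pos B with rfl | h0
        · simp at h
        · exact h0
      obtain ⟨i, hi, hlt⟩ := ih h (by
        rw [Nat.div_lt_iff_lt_mul hB]; rwa [pow_succ] at hb)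
      refine ⟨i + 1, by omega, ?_⟩
      rwa [pow_succ', ← Nat.div_div_eq_div_mul, ← Nat.div_div_eq_div_mul]
    · refine ⟨0, by omega, ?_⟩
      have h1 : a / B = b / B := le_antisymm (Nat.div_le_div_right hab.le) (not_lt.1 h)
      have h2 := Nat.div_add_mod a B
      have h3 := Nat.div_add_mod b B
      rw [h1] at h2
      simp only [pow_zero, Nat.div_one]
      omega

/-- Time is divided into blocks of length `b ^ b`, numbered cyclically by the `b + 1` coordinates.
In a block of number `e` the `e`-th coordinate is zero, and the other coordinates run through all
vectors over `{1, …, b}` in decreasing lexicographic order. -/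
def blockLabel (b t c : ℕ) : ℕ :=
  if c = t / b ^ b % (b + 1) then 0
  else (b ^ b - 1 - t % b ^ b) / b ^ (if c < t / b ^ b % (b + 1) then c else c - 1) % b + 1

theorem blockLabel_lt {b : ℕ} (hb : 0 < b) (t c : ℕ) : blockLabel b t c < b + 1 := by
  unfold blockLabel
  split
  · omega
  · have := Nat.mod_lt ((b ^ b - 1 - t % b ^ b) /
      b ^ (if c < t / b ^ b % (b + 1) then c else c - 1)) hb
    omega

/-- In blocks with different numbers, the coordinate reserved for the block of `t` is zero at `t`
and positive at `s`. Equal numbers force the same block, since `b ^ (b + 1)` is only `b` block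
lengths while numbers recur after `b + 1` blocks; there the descending base-`b` counter drops in
some digit. -/
theorem exists_blockLabel_lt {b s t : ℕ} (hb : 0 < b) (hst : s < t)
    (hts : t ≤ s + b ^ (b + 1)) : ∃ c < b + 1, blockLabel b t c < blockLabel b s c := by
  have hL : 0 < b ^ b := pow_pos hb b
  by_cases he : s / b ^ b % (b + 1) = t / b ^ b % (b + 1)
  · have hblock : s / b ^ b = t / b ^ b := by
      have hle : s / b ^ b ≤ t / b ^ b := Nat.div_le_div_right hst.le
      have hlt : t / b ^ b < s / b ^ b + (b + 1) := by
        rw [Nat.div_lt_iff_lt_mul hL]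
        have h1 := Nat.lt_div_mul_add (a := s) hL
        have h2 : (s / b ^ b + (b + 1)) * b ^ b = s / b ^ b * b ^ b + b ^ b + b ^ (b + 1) := by
          ring
        omega
      have hdvd := (Nat.modEq_iff_dvd' hle).1 he
      have := Nat.eq_zero_of_dvd_of_lt hdvd (by omega)
      omega
    have h1 := Nat.div_add_mod s (b ^ b)
    have h2 := Nat.div_add_mod t (b ^ b)
    have h3 := Nat.mod_lt t hL
    have h4 := Nat.mod_lt s hL
    rw [hblock] at h1
    obtain ⟨i, hi, hlt⟩ := exists_digit_lt (B := b) (n := b)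
      (a := b ^ b - 1 - t % b ^ b) (b := b ^ b - 1 - s % b ^ b)
      (Nat.sub_lt_sub_left (by omega) (by omega))
      (lt_of_le_of_lt (Nat.sub_le _ _) (Nat.sub_lt hL one_pos))
    set e := t / b ^ b % (b + 1) with hedef
    by_cases hie : i < e
    · refine ⟨i, by omega, ?_⟩
      unfold blockLabel
      rw [he, ← hedef, if_neg hie.ne, if_neg hie.ne, if_pos hie]
      omega
    · refine ⟨i + 1, by omega, ?_⟩
      unfold blockLabel
      have h5 : i + 1 ≠ e := by omega
      have h6 : ¬ i + 1 < e := by omega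
      rw [he, ← hedef, if_neg h5, if_neg h5, if_neg h6]
      simpa using hlt
  · refine ⟨t / b ^ b % (b + 1), Nat.mod_lt _ (by omega), ?_⟩
    unfold blockLabel
    rw [if_pos rfl, if_neg (Ne.symm he)]
    omega

/-- With `r = b + 1`, the `r` coordinates take `m` bits each, and `b ^ r = (1 - 1 / r) ^ r * 2 ^ (r
* m)`. Doubling then reaches every larger number of cuts. -/
theorem pow_le_delta {b m : ℕ} (hb : 0 < b) (hm : b + 1 = 2 ^ m) :
    b ^ (b + 1) ≤ delta ((b + 1) * m) := by
  refine le_delta fun n => coveredByCuts_of_card (ι := Fin (b + 1) × Fin m) (by simp)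
    (fun t a => (blockLabel b t a.1).testBit a.2 = true) fun i j h1 h2 _ => ?_
  obtain ⟨c, hc, hlt⟩ := exists_blockLabel_lt hb h1 h2
  obtain ⟨x, hx, h3, h4⟩ := exists_testBit_of_lt hlt (hm ▸ blockLabel_lt hb i c)
  exact ⟨(⟨c, hc⟩, ⟨x, hx⟩), h3, by simp [h4]⟩

theorem one_sub_inv_pow_mul_le_delta {r k : ℕ} (hr : ∃ m : ℕ, r = 2 ^ m)
    (hk : (r : ℝ) * Real.logb 2 (r : ℝ) ≤ (k : ℝ)) :
    (1 - 1 / (r : ℝ)) ^ r * 2 ^ k ≤ (delta k : ℝ) := by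
  obtain ⟨m, hm⟩ := hr
  have hlog : Real.logb 2 (r : ℝ) = m := by
    rw [hm]; push_cast
    rw [Real.logb_pow, Real.logb_self_eq_one (by norm_num), mul_one]
  rw [hlog] at hk
  have hk' : r * m ≤ k := by exact_mod_cast hk
  obtain ⟨b, rfl⟩ : ∃ b, r = b + 1 := ⟨r - 1, by have := Nat.two_pow_pos m; omega⟩
  rcases Nat.eq_zero_or_pos b with rfl | hb
  · simp
  obtain ⟨j, rfl⟩ := Nat.exists_eq_add_of_le hk'
  have h1 : 2 ^ j * b ^ (b + 1) ≤ delta ((b + 1) * m + j) :=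
    (Nat.mul_le_mul_left _ (pow_le_delta hb hm)).trans (two_pow_mul_delta_le _ _)
  have h2 : (2 : ℝ) ^ ((b + 1) * m + j) = ((b + 1 : ℕ) : ℝ) ^ (b + 1) * 2 ^ j := by
    rw [pow_add, mul_comm (b + 1) m, pow_mul, hm]; push_cast; ring
  have h3 : (1 - 1 / ((b + 1 : ℕ) : ℝ)) * ((b + 1 : ℕ) : ℝ) = b := by
    have : ((b + 1 : ℕ) : ℝ) ≠ 0 := by positivity
    rw [sub_mul, one_div, inv_mul_cancel₀ this]; push_cast; ring
  rw [h2, ← mul_assoc, ← mul_pow, h3]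
  have h4 : ((2 ^ j * b ^ (b + 1) : ℕ) : ℝ) ≤ (delta ((b + 1) * m + j) : ℝ) := by
    exact_mod_cast h1
  push_cast at h4
  linarith

theorem one_sub_inv_mul_inv_exp_le {r : ℕ} (hr : 1 ≤ r) :
    (1 - 1 / (r : ℝ)) * (1 / Real.exp 1) ≤ (1 - 1 / (r : ℝ)) ^ r := by
  obtain ⟨b, rfl⟩ : ∃ b, r = b + 1 := ⟨r - 1, by omega⟩
  rcases Nat.eq_zero_or_pos b with rfl | hb
  · simp
  have hb' : (0 : ℝ) < b := by exact_mod_cast hb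
  -- After cancelling one factor, the claim becomes `(1 + 1 / b) ^ b ≤ e`.
  have hq : 1 - 1 / ((b + 1 : ℕ) : ℝ) = (1 + 1 / (b : ℝ))⁻¹ := by
    push_cast; field_simp; ring
  have hpos : (0 : ℝ) < 1 + 1 / (b : ℝ) := by positivity
  rw [hq, pow_succ', one_div (Real.exp 1), inv_pow]
  refine mul_le_mul_of_nonneg_left ?_ (by positivity)
  refine inv_anti₀ (by positivity) ?_
  calc (1 + 1 / (b : ℝ)) ^ b ≤ Real.exp (1 / b) ^ b := by
        gcongr
        rw [add_comm]
        exact Real.add_one_le_exp _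
    _ = Real.exp 1 := by
        rw [← Real.exp_nat_mul]; congr 1; field_simp

theorem five_le_delta_four : 5 ≤ delta 4 := by
  refine le_delta fun n => coveredByCuts_iff.2
    ⟨fun t => ![{0, 1}, {0, 2}, {0, 3}, {1, 2}, {1, 3}, {2, 3}] (Fin.ofNat 6 t),
      fun i j h1 h2 _ => ?_⟩
  have hne : Fin.ofNat 6 i ≠ Fin.ofNat 6 j := by
    intro h
    have := congrArg Fin.val h
    simp only [Fin.val_ofNat] at this
    omega
  beta_reduce
  revert hne
  generalize Fin.ofNat 6 i = a
  generalize Fin.ofNat 6 j = b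
  revert a b
  decide

theorem five_sixteenths_le_delta {k : ℕ} (hk : 4 ≤ k) :
    (5 / 16 : ℝ) * 2 ^ k ≤ (delta k : ℝ) := by
  obtain ⟨j, rfl⟩ := Nat.exists_eq_add_of_le hk
  have h1 : 2 ^ j * 5 ≤ delta (4 + j) :=
    (Nat.mul_le_mul_left _ five_le_delta_four).trans (two_pow_mul_delta_le _ _)
  have h2 : ((2 ^ j * 5 : ℕ) : ℝ) ≤ (delta (4 + j) : ℝ) := by exact_mod_cast h1
  push_cast at h2
  rw [pow_add]
  linarith


/-! ### Paths on `2 ^ k + 1` vertices -/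

theorem two_pow_half_add_le {k u v : ℕ} (h : u + v = k) :
    2 ^ (k / 2) + 2 ^ (k - k / 2) ≤ 2 ^ u + 2 ^ v := by
  wlog huv : u ≤ v generalizing u v
  · rw [add_comm (2 ^ u)]
    exact this (by omega) (by omega)
  obtain ⟨i, hi⟩ := Nat.exists_eq_add_of_le (show u ≤ k / 2 by omega)
  obtain ⟨j, hj⟩ := Nat.exists_eq_add_of_le (show u ≤ k - k / 2 by omega)
  have hv : v = u + i + j := by omega
  obtain ⟨x, hx⟩ := Nat.exists_eq_add_of_lt (Nat.two_pow_pos i)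
  obtain ⟨y, hy⟩ := Nat.exists_eq_add_of_lt (Nat.two_pow_pos j)
  rw [hj, hi, hv]
  simp only [pow_add, hx, hy]
  -- This is `2 ^ i + 2 ^ j ≤ 2 ^ (i + j) + 1`, multiplied by `2 ^ u`.
  have : 0 ≤ 2 ^ u * (x * y) := Nat.zero_le _
  nlinarith

/-- The sets that are incomparable with `S`. -/
def incomparable {α : Type*} [Fintype α] [DecidableEq α] (S : Finset α) : Finset (Finset α) :=
  Finset.univ.filter fun T => ¬ T ⊆ S ∧ ¬ S ⊆ T

theorem card_ssupersets {α : Type*} [Fintype α] [DecidableEq α] (S : Finset α) :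
    (Finset.univ.filter fun T => S ⊂ T).card + 1 = 2 ^ (Fintype.card α - S.card) := by
  have h1 : (Finset.univ.filter fun T => S ⊂ T).card
      = (Sᶜ.powerset.erase ∅).card := by
    refine Finset.card_nbij' (fun T => T \ S) (fun T => S ∪ T) ?_ ?_ ?_ ?_
    · intro T hT
      have hT' : S ⊂ T := by simpa using hT
      simp only [Finset.coe_erase, Set.mem_sdiff, Finset.mem_coe, Finset.mem_powerset,
        Set.mem_singleton_iff]
      refine ⟨fun x hx => by simp at hx ⊢; exact hx.2, fun h => ?_⟩
      exact hT'.2 (Finset.sdiff_eq_empty_iff_subset.1 h)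
    · intro T hT
      simp only [Finset.coe_erase, Set.mem_sdiff, Finset.mem_coe, Finset.mem_powerset,
        Set.mem_singleton_iff] at hT
      simp only [Finset.coe_filter, Finset.mem_univ, true_and, Set.mem_ofPred_eq]
      refine ⟨Finset.subset_union_left, fun h => hT.2 ?_⟩
      ext x
      simp only [Finset.notMem_empty, iff_false]
      intro hx
      exact (Finset.mem_compl.1 (hT.1 hx)) (h (Finset.mem_union_right _ hx))
    · intro T hT
      have hT' : S ⊂ T := by simpa using hT
      exact Finset.union_sdiff_of_subset hT'.1
    · intro T hT
      simp only [Finset.coe_erase, Set.mem_sdiff, Finset.mem_coe, Finset.mem_powerset,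
        Set.mem_singleton_iff] at hT
      ext x
      have := @hT.1 x
      simp only [Finset.mem_compl] at this
      simp only [Finset.mem_sdiff, Finset.mem_union]
      tauto
  rw [h1, Finset.card_erase_add_one (Finset.empty_mem_powerset _), Finset.card_powerset,
    Finset.card_compl]

theorem card_ssubsets_add_one {α : Type*} [DecidableEq α] (S : Finset α) :
    S.ssubsets.card + 1 = 2 ^ S.card := by
  rw [Finset.ssubsets, Finset.card_erase_add_one (Finset.mem_powerset_self S),
    Finset.card_powerset]

theorem card_incomparable {α : Type*} [Fintype α] [DecidableEq α] (S : Finset α) :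
    (incomparable S).card + 2 ^ S.card + 2 ^ (Fintype.card α - S.card)
      = 2 ^ Fintype.card α + 1 := by
  have h1 : (Finset.univ : Finset (Finset α)) = ((incomparable S ∪ S.ssubsets) ∪
      (Finset.univ.filter fun T => S ⊂ T)) ∪ {S} := by
    ext T
    simp only [incomparable, Finset.mem_univ, Finset.mem_union, Finset.mem_filter, true_and,
      Finset.mem_ssubsets, Finset.mem_singleton, true_iff, Finset.ssubset_iff_subset_ne]
    by_cases h : T = S
    · simp [h]
    · have := Ne.symm h
      tauto
  have h2 := congrArg Finset.card h1
  rw [Finset.card_union_of_disjoint, Finset.card_union_of_disjoint,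
    Finset.card_union_of_disjoint, Finset.card_univ, Fintype.card_finset,
    Finset.card_singleton] at h2
  · have h3 := card_ssubsets_add_one S
    have h4 := card_ssupersets S
    omega
  · refine Finset.disjoint_left.2 fun T hT hT' => ?_
    simp only [incomparable, Finset.mem_filter, Finset.mem_ssubsets] at hT hT'
    exact hT.2.1 hT'.1
  · refine Finset.disjoint_left.2 fun T hT hT' => ?_
    simp only [incomparable, Finset.mem_union, Finset.mem_filter, Finset.mem_ssubsets] at hT hT'
    rcases hT with hT | hT
    · exact hT.2.2 hT'.2.1
    · exact hT.2 hT'.2.1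
  · refine Finset.disjoint_left.2 fun T hT hT' => ?_
    simp only [incomparable, Finset.mem_union, Finset.mem_filter, Finset.mem_ssubsets,
      Finset.mem_singleton] at hT hT'
    subst hT'
    simp at hT

/-- Closest repetition: two vertices with the same label whose distance is minimal. -/
theorem exists_closest_repetition {k n : ℕ} (hn : 2 ^ k < n) (f : ℕ → Finset (Fin k)) :
    ∃ s t, s < t ∧ t < n ∧ f s = f t ∧ ∀ i j, s ≤ i → i < j → j < t → f i ≠ f j := by
  classical
  have hex : ∃ e, ∃ s, 0 < e ∧ s + e < n ∧ f s = f (s + e) := by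
    obtain ⟨x, hx, y, hy, hxy, hf⟩ := Finset.exists_ne_map_eq_of_card_lt_of_maps_to
      (s := Finset.range n) (t := (Finset.univ : Finset (Finset (Fin k)))) (f := f)
      (by simpa using hn) (fun _ _ => Finset.mem_coe.2 (Finset.mem_univ _))
    rw [Finset.mem_range] at hx hy
    rcases lt_or_gt_of_ne hxy with h | h
    · exact ⟨y - x, x, by omega, by omega, by rw [hf]; congr 1; omega⟩
    · exact ⟨x - y, y, by omega, by omega, by rw [← hf]; congr 1; omega⟩
  obtain ⟨s, he, hs, hf⟩ := Nat.find_spec hex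
  refine ⟨s, s + Nat.find hex, by omega, hs, hf, fun i j hi hij hj hfij => ?_⟩
  exact Nat.find_min hex (m := j - i) (by omega)
    ⟨i, by omega, by omega, by rw [hfij]; congr 1; omega⟩

/-- Between a closest repetition of `S`, subsets of `S` occur more than `d` before its end and
supersets more than `d` after its start. Moving the superset positions back by `d` keeps them off
the subset positions, so both together fit into `t - d - s - 1` places. At least `d` positions
remain for incomparable labels, which are distinct. -/
theorem IsGood.add_le {n d k : ℕ} (hn : 2 ^ k < n) {f : ℕ → Finset (Fin k)}
    (hf : IsGood n d f) (hd : 0 < d) :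
    d + 2 ^ (k / 2) + 2 ^ (k - k / 2) ≤ 2 ^ k + 1 := by
  classical
  obtain ⟨s, t, hst, htn, hfst, hdist⟩ := exists_closest_repetition hn f
  have hlong : s + d < t := by
    by_contra h
    exact hf s t hst (by omega) htn hfst.le
  set X := (Finset.Ioo s t).filter fun i => f i ⊆ f s with hX
  set Y := (Finset.Ioo s t).filter fun i => f s ⊆ f i with hY
  set Z := (Finset.Ioo s t).filter fun i => ¬ f i ⊆ f s ∧ ¬ f s ⊆ f i with hZ
  have hXlt : ∀ i ∈ X, s < i ∧ i + d < t := by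
    intro i hi
    rw [hX, Finset.mem_filter, Finset.mem_Ioo] at hi
    refine ⟨hi.1.1, ?_⟩
    by_contra h
    exact hf i t hi.1.2 (by omega) htn (hfst ▸ hi.2)
  have hYlt : ∀ i ∈ Y, s + d < i ∧ i < t := by
    intro i hi
    rw [hY, Finset.mem_filter, Finset.mem_Ioo] at hi
    refine ⟨?_, hi.1.2⟩
    by_contra h
    exact hf s i hi.1.1 (by omega) (by omega) hi.2
  have hcover : Finset.Ioo s t ⊆ (X ∪ Y) ∪ Z := by
    intro i hi
    simp only [hX, hY, hZ, Finset.mem_union, Finset.mem_filter]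
    tauto
  have hZcard : Z.card ≤ (incomparable (f s)).card := by
    refine Finset.card_le_card_of_injOn f ?_ ?_
    · intro i hi
      have := (Finset.mem_filter.1 (Finset.mem_coe.1 hi)).2
      simpa [incomparable] using this
    · intro i hi j hj hij
      have hi' := Finset.mem_Ioo.1 (Finset.mem_filter.1 (Finset.mem_coe.1 hi)).1
      have hj' := Finset.mem_Ioo.1 (Finset.mem_filter.1 (Finset.mem_coe.1 hj)).1
      by_contra hne
      rcases lt_or_gt_of_ne hne with h | h
      · exact hdist i j (by omega) h (by omega) hij
      · exact hdist j i (by omega) h (by omega) hij.symm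
  have hYim : (Y.image fun i => i - d).card = Y.card := by
    refine Finset.card_image_of_injOn fun i hi j hj hij => ?_
    have h1 := hYlt i hi
    have h2 := hYlt j hj
    have hij' : i - d = j - d := hij
    omega
  have hdisj : Disjoint X (Y.image fun i => i - d) := by
    refine Finset.disjoint_left.2 fun i hi hi' => ?_
    obtain ⟨j, hj, rfl⟩ := Finset.mem_image.1 hi'
    have h1 := hYlt j hj
    refine hf (j - d) j (by omega) (by omega) (by omega) ?_
    exact (Finset.mem_filter.1 hi).2.trans (Finset.mem_filter.1 hj).2
  have hXY : X.card + Y.card ≤ (Finset.Ioo s (t - d)).card := by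
    rw [← hYim, ← Finset.card_union_of_disjoint hdisj]
    refine Finset.card_le_card fun i hi => ?_
    rw [Finset.mem_Ioo]
    rcases Finset.mem_union.1 hi with hi | hi
    · have := hXlt i hi
      omega
    · obtain ⟨j, hj, rfl⟩ := Finset.mem_image.1 hi
      have := hYlt j hj
      omega
  have hsum := (Finset.card_le_card hcover).trans
    ((Finset.card_union_le _ _).trans (Nat.add_le_add_right (Finset.card_union_le _ _) _))
  rw [Nat.card_Ioo] at hsum hXY
  have hinc := card_incomparable (f s)
  rw [Fintype.card_fin] at hinc
  have hle : (f s).card ≤ k := by simpa using Finset.card_le_univ (f s)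
  have hhalf := two_pow_half_add_le (Nat.add_sub_cancel' hle)
  omega

/-- A family of sets can be listed so that no set is contained in a later one. -/
theorem exists_list_of_family {α : Type*} [DecidableEq α] (F : Finset (Finset α)) :
    ∃ l : List (Finset α), l.length = F.card ∧ (∀ x, x ∈ l ↔ x ∈ F) ∧
      l.Pairwise fun x y => ¬ x ⊆ y := by
  -- A set of largest cardinality goes first: it can lie in a later set only by being equal to it.
  refine Finset.induction_on_max_value Finset.card F ⟨[], by simp⟩ fun a F ha hmax ih => ?_
  · obtain ⟨l, hl, hmem, hpw⟩ := ih
    refine ⟨a :: l, ?_, ?_, ?_⟩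
    · rw [List.length_cons, hl, Finset.card_insert_of_notMem ha]
    · intro x
      rw [List.mem_cons, Finset.mem_insert, hmem]
    · refine List.pairwise_cons.2 ⟨fun y hy hay => ?_, hpw⟩
      have hyF := (hmem y).1 hy
      exact ha (Finset.eq_of_subset_of_card_le hay (hmax y hyF) ▸ hyF)

/-- The only containment from an earlier to a later entry of the list is between the two copies of
`S`, and the incomparable sets keep these more than `d` apart. -/
theorem exists_isGood_of_card {k d : ℕ} (S : Finset (Fin k))
    (hd : d ≤ (incomparable S).card) :
    ∃ f : ℕ → Finset (Fin k), IsGood (2 ^ k + 1) d f := by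
  classical
  obtain ⟨l₁, hl₁, hm₁, hp₁⟩ := exists_list_of_family (Finset.univ.filter fun T => S ⊂ T)
  obtain ⟨l₂, hl₂, hm₂, hp₂⟩ := exists_list_of_family (incomparable S)
  obtain ⟨l₃, hl₃, hm₃, hp₃⟩ := exists_list_of_family S.ssubsets
  simp only [Finset.mem_filter, Finset.mem_univ, true_and] at hm₁
  simp only [incomparable, Finset.mem_filter, Finset.mem_univ, true_and] at hm₂
  simp only [Finset.mem_ssubsets] at hm₃
  set R : Finset (Fin k) → Finset (Fin k) → Prop := fun x y => x ⊆ y → x = S ∧ y = S with hR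
  have hmono : ∀ {l : List (Finset (Fin k))}, (l.Pairwise fun x y => ¬ x ⊆ y) → l.Pairwise R :=
    fun h => h.imp fun hxy hsub => absurd hsub hxy
  set l := l₁ ++ S :: (l₂ ++ S :: l₃) with hl
  have hpw : l.Pairwise R := by
    rw [hl, List.pairwise_append, List.pairwise_cons, List.pairwise_append, List.pairwise_cons]
    refine ⟨hmono hp₁, ⟨?_, hmono hp₂, ⟨?_, hmono hp₃⟩, ?_⟩, ?_⟩
    · intro y hy hsub
      rw [List.mem_append, List.mem_cons, hm₂, hm₃] at hy
      rcases hy with hy | hy | hy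
      · exact absurd hsub hy.2
      · exact ⟨rfl, hy⟩
      · exact absurd hsub hy.2
    · intro y hy hsub
      exact absurd hsub ((hm₃ y).1 hy).2
    · intro x hx y hy hsub
      rw [hm₂] at hx
      rw [List.mem_cons, hm₃] at hy
      rcases hy with rfl | hy
      · exact absurd hsub hx.1
      · exact absurd (hsub.trans hy.1) hx.1
    · intro x hx y hy hsub
      rw [hm₁] at hx
      rw [List.mem_cons, List.mem_append, List.mem_cons, hm₂, hm₃] at hy
      rcases hy with rfl | hy | rfl | hy
      · exact absurd hsub hx.2
      · exact absurd (hx.1.trans hsub) hy.2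
      · exact absurd hsub hx.2
      · exact absurd (hsub.trans hy.1) hx.2
  have hlen : l.length = 2 ^ k + 1 := by
    rw [hl, List.length_append, List.length_cons, List.length_append, List.length_cons,
      hl₁, hl₂, hl₃]
    have h1 := card_incomparable S
    have h2 := card_ssupersets S
    have h3 := card_ssubsets_add_one S
    rw [Fintype.card_fin] at h1 h2
    omega
  have hpos : ∀ i, (h : i < l.length) → l[i] = S → i = l₁.length ∨
      i = l₁.length + 1 + l₂.length := by
    intro i hi hS
    simp only [hl, List.getElem_append, List.getElem_cons] at hS
    split_ifs at hS with h1 h2 h3 h4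
    · exact absurd ((hm₁ S).1 (hS ▸ List.getElem_mem _)) (by simp)
    · left; omega
    · exact absurd ((hm₂ S).1 (hS ▸ List.getElem_mem _)) (by simp)
    · right; omega
    · exact absurd ((hm₃ S).1 (hS ▸ List.getElem_mem _)) (by simp)
  refine ⟨fun i => l.getD i ∅, fun i j hij hjd hjn hsub => ?_⟩
  have hj : j < l.length := by omega
  have hi : i < l.length := by omega
  simp only [List.getD_eq_getElem _ _ hi, List.getD_eq_getElem _ _ hj] at hsub
  obtain ⟨h1, h2⟩ := (List.pairwise_iff_getElem.1 hpw i j hi hj hij) hsub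
  rcases hpos i hi h1 with h3 | h3 <;> rcases hpos j hj h2 with h4 | h4 <;> omega

theorem coveredByCuts_two_pow_add_one_iff {k d : ℕ} :
    CoveredByCuts (pathPower (2 ^ k + 1) d) k ↔
      d = 0 ∨ d + 2 ^ (k / 2) + 2 ^ (k - k / 2) ≤ 2 ^ k + 1 := by
  rw [coveredByCuts_iff]
  constructor
  · rintro ⟨f, hf⟩
    rcases Nat.eq_zero_or_pos d with h | h
    · exact Or.inl h
    · exact Or.inr (hf.add_le (Nat.lt_succ_self _) h)
  · rintro (rfl | h)
    · exact ⟨fun _ => ∅, fun i j h1 h2 => by omega⟩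
    · obtain ⟨S, -, hS⟩ := Finset.exists_subset_card_eq
        (s := (Finset.univ : Finset (Fin k))) (n := k / 2) (by simp; omega)
      refine exists_isGood_of_card S ?_
      have h1 := card_incomparable S
      rw [Fintype.card_fin, hS] at h1
      omega

theorem coveredByCuts_two_pow_add_one_iff_le {k d : ℕ} :
    CoveredByCuts (pathPower (2 ^ k + 1) d) k ↔
      (d : ℤ) ≤ 2 ^ k - 2 ^ ⌊(k : ℚ) / 2⌋₊ - 2 ^ ⌈(k : ℚ) / 2⌉₊ + 1 := by
  have hfloor : ⌊(k : ℚ) / 2⌋₊ = k / 2 := by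
    have := Nat.floor_div_eq_div (K := ℚ) k 2
    exact_mod_cast this
  have hceil : ⌈(k : ℚ) / 2⌉₊ = k - k / 2 := by
    rcases Nat.even_or_odd' k with ⟨m, rfl | rfl⟩
    · have : ((2 * m : ℕ) : ℚ) / 2 = (m : ℕ) := by push_cast; ring
      rw [this, Nat.ceil_natCast]
      omega
    · have h2 : 2 * m + 1 - (2 * m + 1) / 2 = m + 1 := by omega
      rw [h2, Nat.ceil_eq_iff (by omega)]
      push_cast
      constructor <;> linarith
  -- The bound is never negative, so the separate case `d = 0` is absorbed by it.
  have hle : 2 ^ (k / 2) + 2 ^ (k - k / 2) ≤ 2 ^ k + 1 := by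
    have := two_pow_half_add_le (Nat.zero_add k)
    simpa [add_comm] using this
  have hz : (2 ^ (k / 2) + 2 ^ (k - k / 2) : ℤ) ≤ 2 ^ k + 1 := by exact_mod_cast hle
  rw [coveredByCuts_two_pow_add_one_iff, hfloor, hceil]
  constructor
  · rintro (rfl | h)
    · push_cast; linarith
    · have : (d + 2 ^ (k / 2) + 2 ^ (k - k / 2) : ℤ) ≤ 2 ^ k + 1 := by exact_mod_cast h
      linarith
  · intro h
    right
    have : (d + 2 ^ (k / 2) + 2 ^ (k - k / 2) : ℤ) ≤ 2 ^ k + 1 := by linarith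
    exact_mod_cast this


/-! ### The upper bound via the Harris–Kleitman inequality -/

open Finset in
/-- Equality in the Harris–Kleitman inequality forces each coordinate to be irrelevant for one of
the two lower sets. -/
theorem insert_mem_or_of_card_eq {α : Type*} [Fintype α] [DecidableEq α]
    {A B : Finset (Finset α)} (hA : IsLowerSet (A : Set (Finset α)))
    (hB : IsLowerSet (B : Set (Finset α)))
    (heq : #A * #B = 2 ^ Fintype.card α * #(A ∩ B)) (c : α) :
    (∀ X ∈ A, insert c X ∈ A) ∨ (∀ X ∈ B, insert c X ∈ B) := by
  have hsub : ∀ C : Finset (Finset α), (∀ t ∈ C.nonMemberSubfamily c, t ⊆ univ.erase c) ∧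
      ∀ t ∈ C.memberSubfamily c, t ⊆ univ.erase c := by
    intro C
    refine ⟨fun t ht x hx => ?_, fun t ht x hx => ?_⟩
    · rw [mem_nonMemberSubfamily] at ht
      exact mem_erase.2 ⟨fun h => ht.2 (h ▸ hx), mem_univ _⟩
    · rw [mem_memberSubfamily] at ht
      exact mem_erase.2 ⟨fun h => ht.2 (h ▸ hx), mem_univ _⟩
  have hinv : ∀ C : Finset (Finset α), IsLowerSet (C : Set (Finset α)) →
      #(C.nonMemberSubfamily c) ≤ #(C.memberSubfamily c) → ∀ X ∈ C, insert c X ∈ C := by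
    intro C hC hcard X hX
    have he := eq_of_subset_of_card_le hC.memberSubfamily_subset_nonMemberSubfamily hcard
    by_cases hc : c ∈ X
    · rwa [insert_eq_of_mem hc]
    · have : X ∈ C.nonMemberSubfamily c := mem_nonMemberSubfamily.2 ⟨hX, hc⟩
      rw [← he] at this
      exact (mem_memberSubfamily.1 this).1
  -- Let `a₀, b₀` and `a₁, b₁` count the members of `A, B` without and with `c`. The inequality on
  -- both halves and equality overall give `(a₀ - a₁) * (b₀ - b₁) ≤ 0`, while lower sets have `a₁ ≤
  -- a₀` and `b₁ ≤ b₀`.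
  have h0 := (hA.nonMemberSubfamily (a := c)).le_card_inter_finset' (hB.nonMemberSubfamily (a := c))
    (hsub A).1 (hsub B).1
  have h1 := (hA.memberSubfamily (a := c)).le_card_inter_finset' (hB.memberSubfamily (a := c))
    (hsub A).2 (hsub B).2
  rw [← nonMemberSubfamily_inter] at h0
  rw [← memberSubfamily_inter] at h1
  have hA' := card_memberSubfamily_add_card_nonMemberSubfamily c A
  have hB' := card_memberSubfamily_add_card_nonMemberSubfamily c B
  have hAB := card_memberSubfamily_add_card_nonMemberSubfamily c (A ∩ B)
  have hpow : 2 ^ Fintype.card α = 2 * 2 ^ #(univ.erase c) := by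
    rw [← pow_succ', card_erase_add_one (mem_univ c), card_univ]
  rw [hpow, ← hA', ← hB', ← hAB] at heq
  by_contra hcon
  push Not at hcon
  obtain ⟨⟨X, hX, hX'⟩, Y, hY, hY'⟩ := hcon
  have ha : #(A.memberSubfamily c) < #(A.nonMemberSubfamily c) := by
    by_contra h
    exact hX' (hinv A hA (not_lt.1 h) X hX)
  have hb : #(B.memberSubfamily c) < #(B.nonMemberSubfamily c) := by
    by_contra h
    exact hY' (hinv B hB (not_lt.1 h) Y hY)
  nlinarith [Nat.mul_le_mul ha hb]

/-- A recursion of this kind can only be satisfied for a long time by the constant `2 * p`. -/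
theorem le_of_recursion {p : ℕ} {a : ℕ → ℕ} (ha : ∀ j ≤ 2 * p, a j ≤ 4 * p)
    (hrec : ∀ j < 2 * p, 4 * p ^ 2 ≤ a (j + 1) * (4 * p - a j)) : a 0 ≤ 2 * p := by
  by_contra hcon
  have key : ∀ j ≤ 2 * p, 2 * p + 1 + j ≤ a j := by
    intro j hj
    induction j with
    | zero => omega
    | succ j ih =>
      have h1 := ih (by omega)
      have h2 := hrec j (by omega)
      obtain ⟨x, hx⟩ := Nat.exists_eq_add_of_le (ha j (by omega))
      rw [hx, Nat.add_sub_cancel_left] at h2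
      by_contra h3
      -- Without growth, `a j * (4 * p - a j) ≥ 4 * p ^ 2`, which by AM–GM forces `a j = 2 * p`.
      have h4 : a (j + 1) ≤ a j := by omega
      nlinarith [Nat.mul_le_mul_right x h4]
  have h1 := key (2 * p) le_rfl
  have h2 := ha (2 * p) le_rfl
  omega

/-- The sets contained in one of the labels of the `p` vertices from `s` on. -/
def windowDown {k : ℕ} (f : ℕ → Finset (Fin k)) (p s : ℕ) : Finset (Finset (Fin k)) :=
  Finset.univ.filter fun T => ∃ i ∈ Finset.Ico s (s + p), T ⊆ f i

theorem mem_windowDown {k p s : ℕ} {f : ℕ → Finset (Fin k)} {T : Finset (Fin k)} :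
    T ∈ windowDown f p s ↔ ∃ i, s ≤ i ∧ i < s + p ∧ T ⊆ f i := by
  simp [windowDown, and_assoc]

theorem isLowerSet_windowDown {k : ℕ} (f : ℕ → Finset (Fin k)) (p s : ℕ) :
    IsLowerSet (windowDown f p s : Set (Finset (Fin k))) := by
  intro T T' hT hmem
  rw [Finset.mem_coe, mem_windowDown] at hmem ⊢
  obtain ⟨i, h1, h2, h3⟩ := hmem
  exact ⟨i, h1, h2, le_trans hT h3⟩

section

variable {k p n : ℕ} {f : ℕ → Finset (Fin k)}

theorem IsGood.image_window_subset (hf : IsGood n (2 * p - 1) f) {s : ℕ} (hs : s + 2 * p ≤ n) :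
    (Finset.Ico s (s + p)).image f ⊆ windowDown f p s \ windowDown f p (s + p) := by
  intro T hT
  obtain ⟨i, hi, rfl⟩ := Finset.mem_image.1 hT
  rw [Finset.mem_Ico] at hi
  refine Finset.mem_sdiff.2 ⟨mem_windowDown.2 ⟨i, hi.1, hi.2, subset_rfl⟩, fun h => ?_⟩
  obtain ⟨j, h1, h2, h3⟩ := mem_windowDown.1 h
  exact hf i j (by omega) (by omega) (by omega) h3

theorem IsGood.card_image_window (hf : IsGood n (2 * p - 1) f) {s : ℕ} (hs : s + 2 * p ≤ n) :
    ((Finset.Ico s (s + p)).image f).card = p := by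
  rw [Finset.card_image_of_injOn, Nat.card_Ico, Nat.add_sub_cancel_left]
  intro i hi j hj hij
  have hi' := Finset.mem_Ico.1 (Finset.mem_coe.1 hi)
  have hj' := Finset.mem_Ico.1 (Finset.mem_coe.1 hj)
  by_contra hne
  rcases lt_or_gt_of_ne hne with h | h
  · exact hf i j h (by omega) (by omega) hij.le
  · exact hf j i h (by omega) (by omega) hij.ge

theorem IsGood.card_inter_windowDown (hf : IsGood n (2 * p - 1) f) {s : ℕ}
    (hs : s + 2 * p ≤ n) :
    (windowDown f p s ∩ windowDown f p (s + p)).card + p ≤ (windowDown f p s).card := by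
  have h1 := Finset.card_le_card (hf.image_window_subset hs)
  rw [hf.card_image_window hs] at h1
  have h2 := Finset.card_sdiff_add_card_inter (windowDown f p s) (windowDown f p (s + p))
  omega

theorem card_windowDown_le (hk : 2 ^ k = 4 * p) (s : ℕ) : (windowDown f p s).card ≤ 4 * p := by
  rw [← hk]
  simpa using Finset.card_le_univ (windowDown f p s)

/-- For adjacent windows with lower sets `A` and `B`, Harris–Kleitman gives `|A| * |B| ≤ 4 * p * |A
∩ B|`, and the `p` labels of the first window lie in `A` but not in `B`. -/
theorem IsGood.card_windowDown_recursion (hk : 2 ^ k = 4 * p) (hf : IsGood n (2 * p - 1) f)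
    {s : ℕ} (hs : s + 2 * p ≤ n) :
    4 * p ^ 2 ≤ (windowDown f p s).card * (4 * p - (windowDown f p (s + p)).card) := by
  have h1 := (isLowerSet_windowDown f p s).le_card_inter_finset (isLowerSet_windowDown f p (s + p))
  rw [Fintype.card_fin, hk] at h1
  have h2 := hf.card_inter_windowDown hs
  obtain ⟨x, hx⟩ := Nat.exists_eq_add_of_le (card_windowDown_le (f := f) hk (s + p))
  have h3 : 4 * p - (windowDown f p (s + p)).card = x := by omega
  rw [h3]
  have h4 := congrArg (fun y => (windowDown f p s).card * y) hx
  simp only [mul_add] at h4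
  nlinarith [Nat.mul_le_mul_left (4 * p) h2]

/-- The recursion runs backwards in time for the sizes and forwards for their complements in `4 *
p`; hence the margins of `2 * p` windows on both sides. -/
theorem IsGood.card_windowDown_eq (hk : 2 ^ k = 4 * p) (hf : IsGood n (2 * p - 1) f) {s : ℕ}
    (hs : 2 * p * p ≤ s) (hsn : s + 2 * p * p + 2 * p ≤ n) :
    (windowDown f p s).card = 2 * p := by
  refine le_antisymm ?_ ?_
  · refine le_of_recursion (p := p) (a := fun j => (windowDown f p (s - j * p)).card)
      (fun j _ => card_windowDown_le hk _) (fun j hj => ?_) |>.trans_eq' (by simp)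
    have h1 : (j + 1) * p ≤ 2 * p * p := Nat.mul_le_mul_right _ hj
    have h2 : s - j * p = s - (j + 1) * p + p := by
      have : (j + 1) * p = j * p + p := by ring
      omega
    simp only [h2]
    exact hf.card_windowDown_recursion hk (by omega)
  · have h := le_of_recursion (p := p) (a := fun j => 4 * p - (windowDown f p (s + j * p)).card)
      (fun j _ => Nat.sub_le _ _) (fun j hj => ?_)
    · simp only [zero_mul, add_zero] at h
      omega
    · have h1 : (j + 1) * p ≤ 2 * p * p := Nat.mul_le_mul_right _ hj
      have h2 : s + (j + 1) * p = s + j * p + p := by ring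
      simp only [Nat.sub_sub_self (card_windowDown_le (f := f) hk _), h2]
      exact (hf.card_windowDown_recursion hk (by omega)).trans_eq (mul_comm _ _)

theorem IsGood.length_lt (hk : 2 ^ k = 4 * p) (hp : 2 ≤ p) (hf : IsGood n (2 * p - 1) f) :
    n < 4 * p * p + 10 * p := by
  by_contra hcon
  have hn : 4 * p * p + 10 * p ≤ n := not_lt.1 hcon
  have hpp : 4 * p * p = 2 * p * p + 2 * p * p := by ring
  set s₀ := 2 * p * p with hs₀
  -- `J s c` says that `c` is irrelevant for membership in the lower set at `s`. It forces `c` into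
  -- the first label of that window (`hfirst`) and out of the label just before it (`hlast`).
  let J : ℕ → Fin k → Prop := fun s c => ∀ X ∈ windowDown f p s, insert c X ∈ windowDown f p s
  have hcard : ∀ s, s₀ ≤ s → s ≤ s₀ + 8 * p → (windowDown f p s).card = 2 * p :=
    fun s h1 h2 => hf.card_windowDown_eq hk h1 (by omega)
  have hfirst : ∀ s c, s ≤ s₀ + 8 * p → J s c → c ∈ f s := by
    intro s c hs hJ
    obtain ⟨i, h1, h2, h3⟩ := mem_windowDown.1
      (hJ (f s) (mem_windowDown.2 ⟨s, le_rfl, by omega, subset_rfl⟩))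
    rcases h1.eq_or_lt with rfl | h1
    · exact h3 (Finset.mem_insert_self _ _)
    · exact absurd ((Finset.subset_insert _ _).trans h3) (hf s i h1 (by omega) (by omega))
  have hinter : ∀ s, s₀ ≤ s → s ≤ s₀ + 6 * p →
      (windowDown f p s ∩ windowDown f p (s + p)).card = p := by
    intro s h1 h2
    have h3 := (isLowerSet_windowDown f p s).le_card_inter_finset
      (isLowerSet_windowDown f p (s + p))
    have h4 := hf.card_inter_windowDown (s := s) (by omega)
    rw [Fintype.card_fin, hk, hcard s h1 (by omega), hcard (s + p) (by omega) (by omega)] at h3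
    rw [hcard s h1 (by omega)] at h4
    nlinarith
  have hdich : ∀ s c, s₀ ≤ s → s ≤ s₀ + 6 * p → J s c ∨ J (s + p) c := by
    intro s c h1 h2
    refine insert_mem_or_of_card_eq (isLowerSet_windowDown f p s)
      (isLowerSet_windowDown f p (s + p)) ?_ c
    rw [Fintype.card_fin, hk, hinter s h1 h2, hcard s h1 (by omega),
      hcard (s + p) (by omega) (by omega)]
    ring
  have himage : ∀ s, s₀ ≤ s → s ≤ s₀ + 6 * p →
      (Finset.Ico s (s + p)).image f = windowDown f p s \ windowDown f p (s + p) := by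
    intro s h1 h2
    refine Finset.eq_of_subset_of_card_le (hf.image_window_subset (by omega)) ?_
    have h3 := Finset.card_sdiff_add_card_inter (windowDown f p s) (windowDown f p (s + p))
    rw [hinter s h1 h2, hcard s h1 (by omega)] at h3
    rw [hf.card_image_window (by omega)]
    omega
  have hlast : ∀ s c, s₀ ≤ s → s ≤ s₀ + 6 * p → J (s + p) c → c ∉ f (s + p - 1) := by
    intro s c h1 h2 hJ hc
    have hy : f (s + p - 1) ∈ windowDown f p s \ windowDown f p (s + p) := by
      rw [← himage s h1 h2]
      exact Finset.mem_image_of_mem f (Finset.mem_Ico.2 ⟨by omega, by omega⟩)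
    rw [Finset.mem_sdiff] at hy
    have hmem : (f (s + p - 1)).erase c ∈ windowDown f p s \ windowDown f p (s + p) := by
      refine Finset.mem_sdiff.2
        ⟨isLowerSet_windowDown f p s (Finset.erase_subset _ _) hy.1, fun h => ?_⟩
      have := hJ _ h
      rw [Finset.insert_erase hc] at this
      exact hy.2 this
    rw [← himage s h1 h2] at hmem
    obtain ⟨i, hi, hfi⟩ := Finset.mem_image.1 hmem
    rw [Finset.mem_Ico] at hi
    rcases (show i ≤ s + p - 1 by omega).eq_or_lt with rfl | hlt
    · rw [hfi] at hc
      simp at hc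
    · exact hf i (s + p - 1) hlt (by omega) (by omega) (hfi ▸ Finset.erase_subset _ _)
  -- `J` cannot hold at both `t` and `t + 1`, as `f t` would both contain and omit `c`. If it failed
  -- at both, `hdich` would make it hold at both `t + p` and `t + p + 1`.
  have halt : ∀ t c, s₀ + p ≤ t → t ≤ s₀ + 5 * p → (J t c ↔ ¬ J (t + 1) c) := by
    have hnext : ∀ t c, s₀ + p ≤ t → t ≤ s₀ + 6 * p → J t c → ¬ J (t + 1) c := by
      intro t c h1 h2 hJ hJ'
      refine hlast (t + 1 - p) c (by omega) (by omega) ?_ ?_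
      · rwa [Nat.sub_add_cancel (by omega)]
      · rw [show t + 1 - p + p - 1 = t by omega]
        exact hfirst t c (by omega) hJ
    intro t c h1 h2
    refine ⟨hnext t c h1 (by omega), fun h => ?_⟩
    have h3 := (hdich (t + 1) c (by omega) (by omega)).resolve_left h
    rw [show t + 1 + p = t + p + 1 by omega] at h3
    exact (hdich t c (by omega) (by omega)).resolve_right
      fun h4 => hnext (t + p) c (by omega) (by omega) h4 h3
  have hmem : ∀ t c, s₀ + p ≤ t → t ≤ s₀ + 4 * p → (c ∈ f t ↔ J t c) := by
    intro t c h1 h2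
    refine ⟨fun hc => ?_, hfirst t c (by omega)⟩
    by_contra hJ
    have hJ' : J (t + 1) c := by
      by_contra h
      exact hJ ((halt t c h1 (by omega)).2 h)
    refine hlast (t + 1 - p) c (by omega) (by omega) ?_ ?_
    · rwa [Nat.sub_add_cancel (by omega)]
    · rwa [show t + 1 - p + p - 1 = t by omega]
  -- Labels two apart coincide, and `2 ≤ 2 * p - 1` because `p ≥ 2`.
  refine hf (s₀ + p) (s₀ + p + 2) (by omega) (by omega) (by omega) fun c hc => ?_
  rw [hmem _ _ (by omega) (by omega)] at hc ⊢
  by_contra h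
  have h1 := (halt (s₀ + p) c (by omega) (by omega)).1 hc
  exact h1 ((halt (s₀ + p + 1) c (by omega) (by omega)).2 h)

end

theorem delta_add_two_le {k : ℕ} (hk : 3 ≤ k) : delta k + 2 ≤ 2 ^ (k - 1) := by
  obtain ⟨m, rfl⟩ := Nat.exists_eq_add_of_le hk
  set p := 2 ^ (m + 1) with hp
  have h1 : 2 ^ (3 + m) = 4 * p := by rw [hp]; ring
  have h2 : 2 ^ (3 + m - 1) = 2 * p := by
    rw [show 3 + m - 1 = m + 1 + 1 by omega, hp]; ring
  have h3 : 2 ≤ p := by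
    rw [hp, pow_succ]
    have := Nat.two_pow_pos m
    omega
  have h4 : delta (3 + m) < 2 * p - 1 := by
    refine delta_lt_of_not_covered (n := 4 * p * p + 10 * p) fun h => ?_
    obtain ⟨f, hf⟩ := coveredByCuts_iff.1 h
    exact absurd (hf.length_lt h1 h3) (lt_irrefl _)
  omega

theorem delta_le_half {k : ℕ} (hk : 3 ≤ k) : (delta k : ℝ) ≤ (1 / 2 : ℝ) * 2 ^ k - 2 := by
  have h1 := delta_add_two_le hk
  have h2 : ((delta k + 2 : ℕ) : ℝ) ≤ ((2 ^ (k - 1) : ℕ) : ℝ) := by exact_mod_cast h1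
  obtain ⟨m, rfl⟩ : ∃ m, k = m + 1 := ⟨k - 1, by omega⟩
  push_cast at h2
  rw [pow_succ]
  linarith


/-! ### Exhaustive search for three and four cuts -/

/-- A labelling by subsets of a `k`-element set that are encoded as bit masks. -/
def IsMaskGood (k n d : ℕ) (g : ℕ → ℕ) : Prop :=
  (∀ i < n, g i < 2 ^ k) ∧ ∀ i j : ℕ, i < j → j ≤ i + d → j < n → g i &&& g j ≠ g i

theorem IsGood.exists_isMaskGood {k n d : ℕ} {f : ℕ → Finset (Fin k)} (hf : IsGood n d f) :
    ∃ g, IsMaskGood k n d g := by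
  refine ⟨fun i => Nat.ofBits fun a : Fin k => decide (a ∈ f i),
    fun i _ => Nat.ofBits_lt_two_pow _, fun i j h1 h2 h3 heq => hf i j h1 h2 h3 fun a ha => ?_⟩
  have h4 := congrArg (fun x => x.testBit a) heq
  simp only [Nat.testBit_and, Nat.testBit_ofBits_lt _ _ a.isLt, Fin.eta] at h4
  simpa [ha] using h4

/-- The bit mask of all `z < 16` that contain `y` as a mask. -/
def supersetMask (y : ℕ) : ℕ :=
  (List.range 16).foldr (fun z s => bif Nat.beq (Nat.land y z) y then s + 2 ^ z else s) 0

/-- A search state consists of `d` fields of 16 bits; the `j`-th field holds the masks that contain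
one of the last `j + 1` labels. This function appends the label `y`. -/
def pushMask (d y s : ℕ) : ℕ :=
  Nat.land (Nat.lor (s * 2 ^ 16) (supersetMask y * ((2 ^ (16 * d) - 1) / (2 ^ 16 - 1))))
    (2 ^ (16 * d) - 1)

/-- The label `y` contains none of the last `d` labels. -/
def avoids (d s y : ℕ) : Bool := Nat.beq (Nat.land s (2 ^ (16 * (d - 1) + y))) 0

/-- The state after the given labels, the most recent label first. -/
def packMasks (d : ℕ) (w : List ℕ) : ℕ := w.foldr (pushMask d) 0

/-- The function `f` applied to `n`, which the kernel evaluates to a numeral beforehand. -/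
def force (n : ℕ) (f : ℕ → Bool) : Bool := Nat.rec false (fun m _ => f m) (n + 1)

/-- A state can be extended by `m` further labels from a given list. -/
def canExtend (d : ℕ) (allowed : List ℕ) (m : ℕ) : ℕ → Bool :=
  Nat.rec (fun _ => true) (fun _ ih s => force s fun s => allowed.any fun y =>
    avoids d s y && ih (pushMask d y s)) m

/-- The bits of a state that are set are justified by the labels before time `t`. -/
def Justified (d : ℕ) (g : ℕ → ℕ) (s t : ℕ) : Prop :=
  ∀ n < 16 * d, s.testBit n = true → ∃ i < t, t ≤ i + n / 16 + 1 ∧ g i &&& (n % 16) = g i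

theorem justified_nil (d : ℕ) (g : ℕ → ℕ) (t : ℕ) : Justified d g (packMasks d []) t := by
  intro n _ h
  simp [packMasks] at h

/-- In the mask that is added to all fields of a state exactly the supersets are marked. -/
def FieldsCorrect (d : ℕ) : Prop :=
  ∀ y < 16, ∀ n < 16 * d,
    (supersetMask y * ((2 ^ (16 * d) - 1) / (2 ^ 16 - 1))).testBit n = true → y &&& (n % 16) = y

theorem fieldsCorrect_three : FieldsCorrect 3 := by
  unfold FieldsCorrect
  decide +kernel

theorem fieldsCorrect_six : FieldsCorrect 6 := by
  unfold FieldsCorrect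
  decide +kernel

theorem Justified.push {d s t : ℕ} {g : ℕ → ℕ} (hs : Justified d g s t) (hd : FieldsCorrect d)
    (hg : g t < 16) : Justified d g (pushMask d (g t) s) (t + 1) := by
  intro n hn hbit
  change ((s * 2 ^ 16 ||| _) &&& (2 ^ (16 * d) - 1)).testBit n = true at hbit
  rw [Nat.testBit_and, Nat.testBit_or, Nat.testBit_mul_two_pow, Bool.and_eq_true,
    Bool.or_eq_true, Bool.and_eq_true, decide_eq_true_eq] at hbit
  -- A bit comes either from the shift, which ages each field by one step, or from the copy of the
  -- new label's supersets in every field.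
  rcases hbit.1 with ⟨h1, h2⟩ | h1
  · obtain ⟨i, h3, h4, h5⟩ := hs (n - 16) (by omega) h2
    refine ⟨i, by omega, by omega, ?_⟩
    rwa [show n % 16 = (n - 16) % 16 by omega]
  · exact ⟨t, by omega, by omega, hd (g t) hg n hn h1⟩

theorem Justified.cons {d t : ℕ} {g : ℕ → ℕ} {w : List ℕ} (hs : Justified d g (packMasks d w) t)
    (hd : FieldsCorrect d) (hg : g t < 16) : Justified d g (packMasks d (g t :: w)) (t + 1) := by
  have h : packMasks d (g t :: w) = pushMask d (g t) (packMasks d w) := List.foldr_cons ..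
  rw [h]
  exact hs.push hd hg

theorem Justified.avoids_eq_true {d s t y : ℕ} {g : ℕ → ℕ} (hs : Justified d g s t) (hd : 0 < d)
    (hy : y < 16) (h : ∀ i < t, t ≤ i + d → g i &&& y ≠ g i) : avoids d s y = true := by
  have hbit : s.testBit (16 * (d - 1) + y) = false := by
    by_contra hcon
    obtain ⟨i, h1, h2, h3⟩ := hs (16 * (d - 1) + y) (by omega) (by simpa using hcon)
    rw [show (16 * (d - 1) + y) % 16 = y by omega] at h3
    exact h i h1 (by omega) h3
  have hzero : Nat.land s (2 ^ (16 * (d - 1) + y)) = 0 := by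
    change s &&& 2 ^ (16 * (d - 1) + y) = 0
    rw [Nat.and_two_pow, hbit]
    simp
  unfold avoids
  rw [hzero]
  rfl

section

variable {k n d : ℕ} {g : ℕ → ℕ}

theorem IsMaskGood.lt_sixteen (hg : IsMaskGood k n d g) (hk : k ≤ 4) {i : ℕ} (hi : i < n) :
    g i < 16 :=
  (hg.1 i hi).trans_le (Nat.pow_le_pow_right two_pos hk)

theorem IsMaskGood.avoids_eq_true (hg : IsMaskGood k n d g) (hk : k ≤ 4) (hd : 0 < d) {s t : ℕ}
    (ht : t < n) (hs : Justified d g s t) : avoids d s (g t) = true :=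
  hs.avoids_eq_true hd (hg.lt_sixteen hk ht) fun i h1 h2 => hg.2 i t h1 h2 ht

/-- Soundness of the search: set bits have a genuine cause, so an actual labelling is never pruned
and a failed search refutes it. That all forbidden masks are marked is not needed. -/
theorem IsMaskGood.canExtend_eq_true (hg : IsMaskGood k n d g) (hk : k ≤ 4) (hd : 0 < d)
    (hf : FieldsCorrect d) {allowed : List ℕ} {m s t : ℕ} (hs : Justified d g s t)
    (ht : t + m ≤ n) (hmem : ∀ i, t ≤ i → i < t + m → g i ∈ allowed) :
    canExtend d allowed m s = true := by
  induction m generalizing s t with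
  | zero => rfl
  | succ m ih =>
    change (allowed.any fun y => avoids d s y &&
      canExtend d allowed m (pushMask d y s)) = true
    rw [List.any_eq_true]
    refine ⟨g t, hmem t le_rfl (by omega), ?_⟩
    rw [Bool.and_eq_true]
    exact ⟨hg.avoids_eq_true hk hd (by omega) hs,
      ih (hs.push hf (hg.lt_sixteen hk (by omega))) (by omega)
        fun i h1 h2 => hmem i (by omega) (by omega)⟩

end

theorem not_coveredByCuts_eleven : ¬ CoveredByCuts (pathPower 11 3) 3 := by
  intro h
  obtain ⟨f, hf⟩ := coveredByCuts_iff.1 h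
  obtain ⟨g, hg⟩ := hf.exists_isMaskGood
  have hsearch : canExtend 3 [0, 1, 2, 3, 4, 5, 6, 7] 11 (packMasks 3 []) = false := by decide +kernel
  have := hg.canExtend_eq_true (by norm_num) (by norm_num) fieldsCorrect_three
    (justified_nil 3 g 0) (m := 11) (allowed := [0, 1, 2, 3, 4, 5, 6, 7]) (by norm_num)
    fun i _ hi => by
      have := hg.1 i (by omega)
      interval_cases g i <;> simp
  rw [hsearch] at this
  exact absurd this (by simp)

theorem coveredByCuts_of_masks (k d : ℕ) (l : List ℕ)
    (h : ∀ j < l.length, ∀ i < j, j ≤ i + d →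
      ∃ a : Fin k, (l.getD i 0).testBit a = true ∧ ¬ (l.getD j 0).testBit a = true) :
    CoveredByCuts (pathPower l.length d) k :=
  coveredByCuts_of_card (ι := Fin k) (by simp) (fun t a => (l.getD t 0).testBit a = true)
    fun i j h1 h2 h3 => h j h3 i h1 h2

theorem coveredByCuts_ten : CoveredByCuts (pathPower 10 3) 3 :=
  coveredByCuts_of_masks 3 3 [7, 3, 5, 6, 4, 3, 1, 2, 4, 0] (by decide +kernel)

theorem coveredByCuts_twenty_four : CoveredByCuts (pathPower 24 6) 4 :=
  coveredByCuts_of_masks 4 6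
    [15, 7, 11, 13, 9, 14, 10, 12, 7, 3, 5, 6, 9, 10, 12, 8, 3, 5, 1, 6, 2, 4, 8, 0]
    (by decide +kernel)

def allMasks : List ℕ := [0, 1, 2, 3, 4, 5, 6, 7, 8, 9, 10, 11, 12, 13, 14, 15]

/-- The masks with at most two elements. -/
def lowMasks : List ℕ := [0, 1, 2, 4, 8, 3, 5, 6, 9, 10, 12]

def pairMasks : List ℕ := [3, 5, 6, 9, 10, 12]

theorem IsMaskGood.mem_allMasks {n d : ℕ} {g : ℕ → ℕ} (hg : IsMaskGood 4 n d g) {i : ℕ}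
    (hi : i < n) : g i ∈ allMasks := by
  have := hg.1 i hi
  interval_cases g i <;> simp [allMasks]

/-- Reverse the order and take complements. -/
theorem IsMaskGood.reflect {n d : ℕ} {g : ℕ → ℕ} (hg : IsMaskGood 4 n d g) :
    IsMaskGood 4 n d fun i => 15 - g (n - 1 - i) := by
  have key : ∀ x < 16, ∀ y < 16, x &&& y ≠ x → (15 - y) &&& (15 - x) ≠ 15 - y := by
    decide +kernel
  refine ⟨fun i _ => by norm_num; omega, fun i j h1 h2 h3 => ?_⟩
  exact key _ (hg.1 _ (by omega)) _ (hg.1 _ (by omega))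
    (hg.2 (n - 1 - j) (n - 1 - i) (by omega) (by omega) (by omega))

/-- No 11 labels can follow a singleton, whatever came before. With the reflected statement for
triples, this leaves only pairs at times 11, 12 and 13. -/
theorem IsMaskGood.le_of_singleton {g : ℕ → ℕ} (hg : IsMaskGood 4 25 6 g) {s : ℕ} (hs : s < 25)
    (hmem : g s ∈ [1, 2, 4, 8]) : 14 ≤ s := by
  by_contra hlt
  have hsearch : ∀ c ∈ [1, 2, 4, 8], canExtend 6 allMasks 11 (packMasks 6 [c]) = false := by
    decide +kernel
  have := hg.canExtend_eq_true le_rfl (by norm_num) fieldsCorrect_six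
    ((justified_nil 6 g s).cons fieldsCorrect_six (hg.1 s hs)) (m := 11) (by omega)
    fun i _ hi => hg.mem_allMasks (by omega)
  exact absurd (this.symm.trans (hsearch _ hmem)) (by simp)

theorem IsMaskGood.le_of_triple {g : ℕ → ℕ} (hg : IsMaskGood 4 25 6 g) {s : ℕ} (hs : s < 25)
    (hmem : g s ∈ [7, 11, 13, 14]) : s ≤ 10 := by
  have h := hg.reflect.le_of_singleton (s := 24 - s) (by omega) (by
    simp only [show 25 - 1 - (24 - s) = s by omega]
    have key : ∀ x ∈ [7, 11, 13, 14], 15 - x ∈ [1, 2, 4, 8] := by decide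
    exact key _ hmem)
  omega

theorem IsMaskGood.ne_zero {g : ℕ → ℕ} (hg : IsMaskGood 4 25 6 g) {s : ℕ} (hs : s < 24) :
    g s ≠ 0 := by
  intro h
  have := hg.2 s (s + 1) (by omega) (by omega) (by omega)
  simp [h] at this

theorem IsMaskGood.ne_fifteen {g : ℕ → ℕ} (hg : IsMaskGood 4 25 6 g) {s : ℕ} (hs : 0 < s)
    (hs' : s < 25) : g s ≠ 15 := by
  intro h
  have h1 := hg.reflect.ne_zero (s := 24 - s) (by omega)
  simp [show 24 - (24 - s) = s by omega, h] at h1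

theorem IsMaskGood.mem_lowMasks {g : ℕ → ℕ} (hg : IsMaskGood 4 25 6 g) {s : ℕ} (hs : 10 < s)
    (hs' : s < 25) : g s ∈ lowMasks := by
  have h1 : g s ∉ [7, 11, 13, 14] := fun h => by
    have := hg.le_of_triple hs' h
    omega
  have h2 := hg.ne_fifteen (by omega) hs'
  have key : ∀ x < 16, x ∉ [7, 11, 13, 14] → x ≠ 15 → x ∈ lowMasks := by decide
  exact key _ (hg.1 s hs') h1 h2

theorem IsMaskGood.mem_pairMasks {g : ℕ → ℕ} (hg : IsMaskGood 4 25 6 g) {s : ℕ} (hs : 10 < s)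
    (hs' : s < 14) : g s ∈ pairMasks := by
  have h1 : g s ∉ [1, 2, 4, 8] := fun h => by
    have := hg.le_of_singleton (by omega) h
    omega
  have h2 := hg.ne_zero (s := s) (by omega)
  have key : ∀ x ∈ lowMasks, x ∉ [1, 2, 4, 8] → x ≠ 0 → x ∈ pairMasks := by decide
  exact key _ (hg.mem_lowMasks hs (by omega)) h1 h2

/-- Representatives of the triples of distinct pairs, the last pair first. -/
def pairTriples : List (List ℕ) := [[6, 5, 3], [9, 5, 3], [10, 5, 3], [10, 3, 5], [3, 10, 5]]

theorem pairTriples_not_extendable : (pairTriples.all fun w =>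
    lowMasks.all fun x => !avoids 6 (packMasks 6 w) x ||
    lowMasks.all fun y => !avoids 6 (packMasks 6 (x :: w)) y ||
    lowMasks.all fun z => !avoids 6 (packMasks 6 (y :: x :: w)) z ||
      !(canExtend 6 lowMasks 8 (packMasks 6 (z :: y :: x :: w)) &&
        canExtend 6 allMasks 11
          (packMasks 6 ((z :: y :: x :: w).reverse.map fun v => 15 - v)))) = true := by
  decide +kernel

/-- Viewed as edges of `K₄`, three distinct pairs form a triangle, a star, or a path with its middle
edge first, second or last. In each case the labels at times 11 to 16 cannot extend both forwards to
time 24 and, reflected, backwards to time 0. -/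
theorem IsMaskGood.notMem_pairTriples {g : ℕ → ℕ} (hg : IsMaskGood 4 25 6 g) :
    [g 13, g 12, g 11] ∉ pairTriples := by
  intro hw
  have hlt : ∀ {i}, i < 25 → g i < 16 := fun hi => hg.1 _ hi
  have h3 := (((justified_nil 6 g 11).cons fieldsCorrect_six (hlt (by norm_num))).cons
    fieldsCorrect_six (hlt (by norm_num))).cons fieldsCorrect_six (hlt (by norm_num))
  have h4 := h3.cons fieldsCorrect_six (hlt (by norm_num))
  have h5 := h4.cons fieldsCorrect_six (hlt (by norm_num))
  have h6 := h5.cons fieldsCorrect_six (hlt (by norm_num))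
  have hr := hg.reflect
  have hlt' : ∀ {i}, i < 25 → 15 - g (25 - 1 - i) < 16 := fun hi => hr.1 _ hi
  have h7 := (((justified_nil 6 (fun i => 15 - g (25 - 1 - i)) 8).cons
    fieldsCorrect_six (hlt' (by norm_num))).cons fieldsCorrect_six (hlt' (by norm_num))).cons
    fieldsCorrect_six (hlt' (by norm_num))
  have h8 := ((h7.cons fieldsCorrect_six (hlt' (by norm_num))).cons
    fieldsCorrect_six (hlt' (by norm_num))).cons fieldsCorrect_six (hlt' (by norm_num))
  simp only [Nat.reduceAdd, Nat.reduceSub] at h3 h4 h5 h6 h8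
  have hforward := hg.canExtend_eq_true le_rfl (by norm_num) fieldsCorrect_six h6 (m := 8)
    (allowed := lowMasks) (by norm_num) fun i h1 h2 => hg.mem_lowMasks (by omega) (by omega)
  have hbackward := hr.canExtend_eq_true le_rfl (by norm_num) fieldsCorrect_six h8 (m := 11)
    (allowed := allMasks) (by norm_num) fun i h1 h2 => hr.mem_allMasks (by omega)
  have hcheck := List.all_eq_true.1 pairTriples_not_extendable _ hw
  have hx := List.all_eq_true.1 hcheck _ (hg.mem_lowMasks (s := 14) (by norm_num) (by norm_num))
  rw [hg.avoids_eq_true le_rfl (by norm_num) (by norm_num) h3, Bool.not_true, Bool.false_or] at hx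
  have hy := List.all_eq_true.1 hx _ (hg.mem_lowMasks (s := 15) (by norm_num) (by norm_num))
  rw [hg.avoids_eq_true le_rfl (by norm_num) (by norm_num) h4, Bool.not_true, Bool.false_or] at hy
  have hz := List.all_eq_true.1 hy _ (hg.mem_lowMasks (s := 16) (by norm_num) (by norm_num))
  simp only [List.reverse_cons, List.reverse_nil, List.nil_append, List.cons_append, List.map_cons,
    List.map_nil] at hz
  rw [hg.avoids_eq_true le_rfl (by norm_num) (by norm_num) h5, hforward, hbackward] at hz
  simp at hz

/-- The action on masks of the permutation that maps the elements of a four-element set to the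
elements with the given singleton masks. -/
def permuteMask (l : List ℕ) (x : ℕ) : ℕ :=
  match l with
  | [a, b, c, d] => x % 2 * a + x / 2 % 2 * b + x / 4 % 2 * c + x / 8 % 2 * d
  | _ => 0

theorem IsMaskGood.permute {n d : ℕ} {g : ℕ → ℕ} (hg : IsMaskGood 4 n d g) {l : List ℕ}
    (hl : l ∈ [1, 2, 4, 8].permutations') : IsMaskGood 4 n d fun i => permuteMask l (g i) := by
  have key : ∀ l ∈ [1, 2, 4, 8].permutations', ∀ x < 16, permuteMask l x < 16 ∧
      ∀ y < 16, x &&& y ≠ x → permuteMask l x &&& permuteMask l y ≠ permuteMask l x := by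
    decide +kernel
  exact ⟨fun i hi => (key l hl _ (hg.1 i hi)).1, fun i j h1 h2 h3 =>
    (key l hl _ (hg.1 i (by omega))).2 _ (hg.1 j h3) (hg.2 i j h1 h2 h3)⟩

theorem exists_permuteMask_mem_pairTriples : ∀ x ∈ pairMasks, ∀ y ∈ pairMasks,
    ∀ z ∈ pairMasks, x ≠ y → y ≠ z → x ≠ z → ∃ l ∈ [1, 2, 4, 8].permutations',
      [permuteMask l z, permuteMask l y, permuteMask l x] ∈ pairTriples := by
  decide +kernel

theorem not_coveredByCuts_twenty_five : ¬ CoveredByCuts (pathPower 25 6) 4 := by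
  intro h
  obtain ⟨f, hf⟩ := coveredByCuts_iff.1 h
  obtain ⟨g, hg⟩ := hf.exists_isMaskGood
  have hne : ∀ i j, i < j → j ≤ i + 6 → j < 25 → g i ≠ g j := fun i j h1 h2 h3 h4 =>
    hg.2 i j h1 h2 h3 (by rw [← h4, Nat.and_self])
  obtain ⟨l, hl, hmem⟩ := exists_permuteMask_mem_pairTriples
    _ (hg.mem_pairMasks (s := 11) (by norm_num) (by norm_num))
    _ (hg.mem_pairMasks (s := 12) (by norm_num) (by norm_num))
    _ (hg.mem_pairMasks (s := 13) (by norm_num) (by norm_num))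
    (hne _ _ (by norm_num) (by norm_num) (by norm_num))
    (hne _ _ (by norm_num) (by norm_num) (by norm_num))
    (hne _ _ (by norm_num) (by norm_num) (by norm_num))
  exact (hg.permute hl).notMem_pairTriples hmem

/-! ### Exact thresholds and values -/

theorem coveredByCuts_iff_le {m d k : ℕ} (h1 : CoveredByCuts (pathPower m d) k)
    (h2 : ¬ CoveredByCuts (pathPower (m + 1) d) k) (n : ℕ) :
    CoveredByCuts (pathPower n d) k ↔ n ≤ m := by
  refine ⟨fun h => ?_, fun h => h1.mono h le_rfl⟩
  by_contra hlt
  exact h2 (h.mono (by omega) le_rfl)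

theorem delta_three : delta 3 = 2 := by
  refine le_antisymm (Nat.lt_succ_iff.1 (delta_lt_of_not_covered not_coveredByCuts_eleven))
    (le_delta fun n => coveredByCuts_of_card (ι := Fin 3) (by simp)
      (fun t a => t % 3 = a) fun i j h1 h2 _ => ?_)
  exact ⟨⟨i % 3, Nat.mod_lt _ (by norm_num)⟩, rfl, by
    change ¬ j % 3 = i % 3
    omega⟩

theorem delta_four : delta 4 = 5 :=
  le_antisymm (Nat.lt_succ_iff.1 (delta_lt_of_not_covered not_coveredByCuts_twenty_five))
    five_le_delta_four

end CutCover

theorem theorem1p2 :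
    (∀ k : ℕ, 4 ≤ k → (5 / 16 : ℝ) * 2 ^ k ≤ (CutCover.delta k : ℝ)) ∧
    (∀ r k : ℕ, (∃ m : ℕ, r = 2 ^ m) → 1 ≤ k → (r : ℝ) * Real.logb 2 (r : ℝ) ≤ (k : ℝ) →
      (1 - 1 / (r : ℝ)) ^ r * 2 ^ k ≤ (CutCover.delta k : ℝ) ∧
      (1 - 1 / (r : ℝ)) * (1 / Real.exp 1) * 2 ^ k ≤ (1 - 1 / (r : ℝ)) ^ r * 2 ^ k) ∧
    (∀ k d : ℕ, 1 ≤ k →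
      (CutCover.CoveredByCuts (CutCover.pathPower (2 ^ k + 1) d) k ↔
        (d : ℤ) ≤ 2 ^ k - 2 ^ ⌊(k : ℚ) / 2⌋₊ - 2 ^ ⌈(k : ℚ) / 2⌉₊ + 1)) ∧
    ((∀ n : ℕ, CutCover.CoveredByCuts (CutCover.pathPower n 3) 3 ↔ n ≤ 10) ∧
      CutCover.delta 3 = 2) ∧
    ((∀ n : ℕ, CutCover.CoveredByCuts (CutCover.pathPower n 6) 4 ↔ n ≤ 24) ∧
      CutCover.delta 4 = 5) ∧
    (∀ k : ℕ, 3 ≤ k → (CutCover.delta k : ℝ) ≤ (1 / 2 : ℝ) * 2 ^ k - 2) :=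
  ⟨fun _ hk => CutCover.five_sixteenths_le_delta hk,
    fun r _ hr _ hk => ⟨CutCover.one_sub_inv_pow_mul_le_delta hr hk, by
      obtain ⟨m, rfl⟩ := hr
      exact mul_le_mul_of_nonneg_right
        (CutCover.one_sub_inv_mul_inv_exp_le Nat.one_le_two_pow) (by positivity)⟩,
    fun _ _ _ => CutCover.coveredByCuts_two_pow_add_one_iff_le,
    ⟨CutCover.coveredByCuts_iff_le CutCover.coveredByCuts_ten CutCover.not_coveredByCuts_eleven,
      CutCover.delta_three⟩,
    ⟨CutCover.coveredByCuts_iff_le CutCover.coveredByCuts_twenty_four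
      CutCover.not_coveredByCuts_twenty_five, CutCover.delta_four⟩,
    fun _ hk => CutCover.delta_le_half hk⟩
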